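/- **Definitions.** A $qcb_0$ space is a $T_0$ topological space $X$ that has an admissible representation: a surjective map $\rho : A \to X$ with $A \subseteq 2^\omega$ such that $X$ carries the quotient topology induced by $\rho$, and every continuous map $\varphi : B \to X$ with $B \subseteq 2^\omega$ is of the form $\varphi = \rho \circ F$ with $F : B \to A$ continuous. For points of a space write $x \sqsubseteq y$ if every open set containing $x$ contains $y$. A topological predomain is a $qcb_0$ space in which every ascending chain $x_0 \sqsubseteq x_1 \sqsubseteq \cdots$ has an upper bound $x$ with $x_n \to x$. Let $\mathbf{TP}_\omega$ be the category of countably based (i.e. second countable) topological predomains and continuous maps. For topological spaces $X, Y$, let $X \Rightarrow Y$ be the set of continuous maps $X \to Y$ with the exponential topology of $qcb_0$ spaces: $G$ is open iff it is sequentially open for continuous convergence, where $f_n \to f$ continuously means that $f_n(x_n) \to f(x)$ whenever $x_n \to x$. Let $\mathcal O^{\subseteq}(D)$ be the lattice of open sets of $D$ ordered by inclusion, and $[0,1]^\uparrow$ the unit interval with its usual order, both with the Scott topology. A (continuous) valuation on $D$ is an element $\nu$ of $\mathcal O^{\subseteq}(D) \Rightarrow [0,1]^\uparrow$ that is strict ($\nu(\emptyset)=0$),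 monotone, and modular ($\nu(U)+\nu(V)=\nu(U\cup V)+\nu(U\cap V)$); the set $\mathcal V(D)$ of valuations carries the subspace topology. **Proposition.** The following assignments are well-defined functors $\mathbf{TP}_\omega \to \mathbf{TP}_\omega$: 1. $D \mapsto \bigl(\mathcal O^{\subseteq}(D) \Rightarrow [0,1]^\uparrow\bigr)$, sending a continuous map $f : D \to E$ to the pushforward $\mu \mapsto \mu \circ f^{-1}$; 2. the probability functor $D \mapsto \mathcal V(D)$, sending a continuous map $f : D \to E$ to the pushforward $\mu \mapsto \mu \circ f^{-1}$ on valuations. That is, in each case, for every $D$ in $\mathbf{TP}_\omega$ the space assigned to $D$ is again a countably based topological predomain; for every continuous $f : D \to E$ the map $\mu \mapsto \mu \circ f^{-1}$ takes values in the space assigned to $E$ and is continuous; and identities and composition are preserved. -/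

import Mathlib

open Filter Topology TopologicalSpace CategoryTheory

universe u v

namespace TopDom

/-- `ρ : A → X`, with `A` a subset of Cantor space, is an admissible representation of the
topological space `X`: it is surjective, the topology of `X` is the final (quotient) topology
induced by `ρ`, and every continuous partial map from Cantor space to `X` (in particular every
continuous representation of `X`) factors through `ρ` by a continuous realizer. -/
def IsAdmissibleRep {X : Type u} [TopologicalSpace X] (A : Set (ℕ → Bool)) (ρ : A → X) : Prop :=
  IsQuotientMap ρ ∧
    ∀ (B : Set (ℕ → Bool)) (φ : B → X), Continuous φ → ∃ F : B → A, Continuous F ∧ ρ ∘ F = φ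

/-- A `qcb₀` space: a `T₀` topological space with an admissible representation on (a subset of)
Cantor space. -/
def IsQCB0 (X : Type u) [TopologicalSpace X] : Prop :=
  T0Space X ∧ ∃ (A : Set (ℕ → Bool)) (ρ : A → X), IsAdmissibleRep A ρ

/-- The specialization preorder `x ⊑ y`: every open set that contains `x` also contains `y`.
(Mathlib's `x ⤳ y` is the opposite relation.) -/
def SpecLE {X : Type u} [TopologicalSpace X] (x y : X) : Prop :=
  ∀ U : Set X, IsOpen U → x ∈ U → y ∈ U

/-- A topological predomain: a `qcb₀` space in which every ascending chain (for the
specialization preorder) has an upper bound to which it converges. -/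
def IsTopologicalPredomain (X : Type u) [TopologicalSpace X] : Prop :=
  IsQCB0 X ∧
    ∀ c : ℕ → X, (∀ n, SpecLE (c n) (c (n + 1))) →
      ∃ x : X, (∀ n, SpecLE (c n) x) ∧ Tendsto c atTop (𝓝 x)

/-- Countably based topological predomains, as a property of topological spaces. -/
def isCountablyBasedPredomain : ObjectProperty TopCat.{u} :=
  fun X => IsTopologicalPredomain X ∧ SecondCountableTopology X

/-- The category `TP_ω`: countably based topological predomains and continuous maps. -/
abbrev TPω := (isCountablyBasedPredomain.{u}).FullSubcategory

/-- The underlying set of the function space `X ⇒ Y`: all continuous maps. It is a separate type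
because Mathlib puts the compact-open topology on `C(X, Y)`. -/
def FunSpace (X : Type u) (Y : Type v) [TopologicalSpace X] [TopologicalSpace Y] := C(X, Y)

section FunSpace

variable {X : Type u} {Y : Type v} [TopologicalSpace X] [TopologicalSpace Y]

instance : FunLike (FunSpace X Y) X Y := inferInstanceAs (FunLike C(X, Y) X Y)

instance : ContinuousMapClass (FunSpace X Y) X Y :=
  inferInstanceAs (ContinuousMapClass C(X, Y) X Y)

/-- Continuous convergence of a sequence of functions: `f n (x n) → g a` whenever `x n → a`. -/
def ContConv (f : ℕ → FunSpace X Y) (g : FunSpace X Y) : Prop :=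
  ∀ (x : ℕ → X) (a : X), Tendsto x atTop (𝓝 a) → Tendsto (fun n => f n (x n)) atTop (𝓝 (g a))

/-- The topology of the exponential `X ⇒ Y` of `qcb₀` spaces: a set is open iff it is sequentially
open for continuous convergence. -/
instance : TopologicalSpace (FunSpace X Y) where
  IsOpen G := ∀ (f : ℕ → FunSpace X Y) (g : FunSpace X Y), g ∈ G → ContConv f g →
    ∀ᶠ n in atTop, f n ∈ G
  isOpen_univ := fun _ _ _ _ => Eventually.of_forall fun _ => trivial
  isOpen_inter := fun _ _ hs ht f g hg hf => (hs f g hg.1 hf).and (ht f g hg.2 hf)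
  isOpen_sUnion := fun _ hS f g ⟨t, ht, hgt⟩ hf =>
    (hS t ht f g hgt hf).mono fun _ hn => ⟨t, ht, hn⟩

end FunSpace

/-- The function space `𝒪^⊆(X) ⇒ [0,1]^↑`, where `𝒪^⊆(X)` is the complete lattice of opens of `X`
and `[0,1]^↑` the unit interval with its usual order, both with the Scott topology. -/
abbrev OpensToUnit (X : Type u) [TopologicalSpace X] :=
  FunSpace (Topology.WithScott (Opens X)) (Topology.WithScott unitInterval)

/-- The value of `ν : 𝒪^⊆(X) ⇒ [0,1]^↑` at an open set `U`, as a point of the unit interval. -/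
def OpensToUnit.val {X : Type u} [TopologicalSpace X] (ν : OpensToUnit X) (U : Opens X) :
    unitInterval :=
  Topology.WithScott.ofScott (ν (Topology.WithScott.toScott U))

/-- A valuation: strict, monotone and modular. -/
structure IsValuation {X : Type u} [TopologicalSpace X] (ν : OpensToUnit X) : Prop where
  strict : ν.val ⊥ = 0
  monotone : ∀ U V : Opens X, U ≤ V → ν.val U ≤ ν.val V
  modular : ∀ U V : Opens X,
    (ν.val U : ℝ) + (ν.val V : ℝ) = (ν.val (U ⊔ V) : ℝ) + (ν.val (U ⊓ V) : ℝ)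

/-- The space of (continuous) valuations on `X`, a subspace of `𝒪^⊆(X) ⇒ [0,1]^↑`. -/
abbrev Valuation (X : Type u) [TopologicalSpace X] := {ν : OpensToUnit X // IsValuation ν}

end TopDom

namespace TopDom

/-! ### Second countable `T₀` spaces are `qcb₀` spaces -/

section Admissible

/-- The set of indices `n` that a point `p` of Cantor space enumerates. -/
def enumerated (p : ℕ → Bool) : Set ℕ := {n | ∃ k, p (Nat.pair n k) = true}

lemma isOpen_setOf_mem_enumerated (n : ℕ) : IsOpen {p : ℕ → Bool | n ∈ enumerated p} := by
  have : {p : ℕ → Bool | n ∈ enumerated p} = ⋃ k, (fun p => p (Nat.pair n k)) ⁻¹' {true} := by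
    ext p; simp [enumerated]
  rw [this]
  exact isOpen_iUnion fun k => (isOpen_discrete _).preimage (continuous_apply _)

/-- The domain of the standard representation of a space with basis `b`: the points of Cantor space
that enumerate the indices of the basic neighbourhoods of some point. -/
def standardDomain {X : Type u} (b : ℕ → Set X) : Set (ℕ → Bool) :=
  {p | ∃ x, enumerated p = {n | x ∈ b n}}

/-- The standard representation of a space with basis `b`. -/
noncomputable def standardRep {X : Type u} (b : ℕ → Set X) (p : standardDomain b) : X :=
  p.2.choose

lemma mem_standardRep {X : Type u} (b : ℕ → Set X) (p : standardDomain b) (n : ℕ) :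
    standardRep b p ∈ b n ↔ n ∈ enumerated p := by
  have h : enumerated p = {n | standardRep b p ∈ b n} := p.2.choose_spec
  rw [h]; rfl

variable {X : Type u} [TopologicalSpace X] {b : ℕ → Set X}

lemma eq_of_forall_mem_iff [T0Space X] (hb : IsTopologicalBasis (Set.range b)) {x y : X}
    (h : ∀ n, x ∈ b n ↔ y ∈ b n) : x = y := by
  refine (hb.inseparable_iff.2 ?_).eq
  rintro _ ⟨n, rfl⟩
  exact h n

lemma continuous_standardRep (hb : IsTopologicalBasis (Set.range b)) :
    Continuous (standardRep b) := by
  refine hb.continuous_iff.2 ?_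
  rintro _ ⟨n, rfl⟩
  have : standardRep b ⁻¹' b n = Subtype.val ⁻¹' {p : ℕ → Bool | n ∈ enumerated p} := by
    ext p; exact mem_standardRep b p n
  rw [this]
  exact (isOpen_setOf_mem_enumerated n).preimage continuous_subtype_val

/-- Any point of the basic open sets listed by a finite prefix of a name has a name with that
prefix. -/
lemma exists_mem_cylinder_standardRep_eq [T0Space X] (hb : IsTopologicalBasis (Set.range b))
    (p : ℕ → Bool) (N : ℕ) (x : X) (h : ∀ i < N, p i = true → x ∈ b (Nat.unpair i).1) :
    ∃ q : standardDomain b, (q : ℕ → Bool) ∈ PiNat.cylinder p N ∧ standardRep b q = x := by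
  classical
  set q : ℕ → Bool := fun i => if i < N then p i else decide (x ∈ b (Nat.unpair i).1) with hq
  have henum : enumerated q = {n | x ∈ b n} := by
    ext n
    constructor
    · rintro ⟨k, hk⟩
      by_cases hlt : Nat.pair n k < N
      · have := h _ hlt (by simpa [hq, hlt] using hk)
        simpa using this
      · simpa [hq, hlt] using hk
    · intro hx
      refine ⟨N, ?_⟩
      have hlt : ¬ Nat.pair n N < N := not_lt.2 (Nat.right_le_pair n N)
      have hx : x ∈ b n := hx
      simp [hq, hlt, hx]
  refine ⟨⟨q, x, henum⟩, ?_, ?_⟩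
  · intro i hi
    have hi : i < N := by simpa using hi
    simp [hq, hi]
  · refine eq_of_forall_mem_iff hb fun n => ?_
    rw [mem_standardRep]
    change n ∈ enumerated q ↔ _
    rw [henum]; rfl

lemma isOpenMap_standardRep [T0Space X] (hb : IsTopologicalBasis (Set.range b)) :
    IsOpenMap (standardRep b) := by
  rintro _ ⟨V, hV, rfl⟩
  refine isOpen_iff_mem_nhds.2 ?_
  rintro _ ⟨p, hp, rfl⟩
  obtain ⟨_, ⟨c, N, rfl⟩, hpc, hcV⟩ :=
    (PiNat.isTopologicalBasis_cylinders fun _ => Bool).exists_subset_of_mem_open hp hV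
  have hc : PiNat.cylinder (p : ℕ → Bool) N = PiNat.cylinder c N := PiNat.mem_cylinder_iff_eq.1 hpc
  have hfin : ∀ᶠ x in 𝓝 (standardRep b p), ∀ i < N, (p : ℕ → Bool) i = true →
      x ∈ b (Nat.unpair i).1 := by
    refine (eventually_all_finite (Set.finite_lt_nat N)).2 fun i _ => ?_
    by_cases hi : (p : ℕ → Bool) i = true
    · have hmem : standardRep b p ∈ b (Nat.unpair i).1 :=
        (mem_standardRep b p _).2 ⟨(Nat.unpair i).2, by simpa using hi⟩
      filter_upwards [(hb.isOpen ⟨_, rfl⟩).mem_nhds hmem] with x hx _ using hx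
    · exact Eventually.of_forall fun _ h => absurd h hi
  filter_upwards [hfin] with x hx
  obtain ⟨q, hq, rfl⟩ := exists_mem_cylinder_standardRep_eq hb p N x hx
  exact ⟨q, hcV (hc ▸ hq), rfl⟩

lemma surjective_standardRep [T0Space X] (hb : IsTopologicalBasis (Set.range b)) :
    Function.Surjective (standardRep b) := fun x => by
  obtain ⟨q, -, hq⟩ := exists_mem_cylinder_standardRep_eq hb (fun _ => false) 0 x (by simp)
  exact ⟨q, hq⟩

lemma exists_continuous_lift_standardRep [T0Space X] (hb : IsTopologicalBasis (Set.range b))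
    (B : Set (ℕ → Bool)) (φ : B → X) (hφ : Continuous φ) :
    ∃ F : B → standardDomain b, Continuous F ∧ standardRep b ∘ F = φ := by
  classical
  set P : B → ℕ → Prop := fun c i =>
    ∀ d : B, (d : ℕ → Bool) ∈ PiNat.cylinder (c : ℕ → Bool) (Nat.unpair i).2 →
      φ d ∈ b (Nat.unpair i).1 with hP
  have henum : ∀ c : B, enumerated (fun i => decide (P c i)) = {n | φ c ∈ b n} := by
    intro c
    ext n
    constructor
    · rintro ⟨k, hk⟩
      have hk : P c (Nat.pair n k) := by simpa using hk
      simpa using hk c (PiNat.self_mem_cylinder _ _)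
    · intro hn
      obtain ⟨V, hV, hVeq⟩ := (hb.isOpen ⟨n, rfl⟩).preimage hφ
      have hcV : (c : ℕ → Bool) ∈ V := by
        have : c ∈ Subtype.val ⁻¹' V := hVeq ▸ hn
        exact this
      obtain ⟨_, ⟨e, N, rfl⟩, hce, heV⟩ :=
        (PiNat.isTopologicalBasis_cylinders fun _ => Bool).exists_subset_of_mem_open hcV hV
      have he : PiNat.cylinder (c : ℕ → Bool) N = PiNat.cylinder e N :=
        PiNat.mem_cylinder_iff_eq.1 hce
      refine ⟨N, ?_⟩
      have : P c (Nat.pair n N) := by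
        intro d hd
        simp only [Nat.unpair_pair] at hd ⊢
        have : d ∈ Subtype.val ⁻¹' V := heV (he ▸ hd)
        rw [hVeq] at this
        exact this
      simpa using this
  refine ⟨fun c => ⟨fun i => decide (P c i), φ c, henum c⟩, ?_, ?_⟩
  · refine Continuous.subtype_mk (continuous_pi fun i => ?_) _
    refine IsLocallyConstant.continuous ?_
    refine (IsLocallyConstant.iff_eventually_eq _).2 fun c => ?_
    have hopen := (PiNat.isOpen_cylinder (fun _ => Bool) (c : ℕ → Bool) (Nat.unpair i).2).preimage
      (continuous_subtype_val (p := (· ∈ B)))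
    filter_upwards [hopen.mem_nhds (PiNat.self_mem_cylinder _ _)] with d hd
    have hd : PiNat.cylinder (d : ℕ → Bool) (Nat.unpair i).2 =
        PiNat.cylinder (c : ℕ → Bool) (Nat.unpair i).2 := PiNat.mem_cylinder_iff_eq.1 hd
    have : P d i ↔ P c i := by simp only [hP, hd]
    simp only [this]
  · funext c
    refine eq_of_forall_mem_iff hb fun n => ?_
    rw [Function.comp_apply, mem_standardRep]
    change n ∈ enumerated (fun i => decide (P c i)) ↔ _
    rw [henum]; rfl

lemma isQCB0_of_secondCountable (X : Type u) [TopologicalSpace X] [T0Space X]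
    [SecondCountableTopology X] : IsQCB0 X := by
  refine ⟨inferInstance, ?_⟩
  obtain ⟨b, hb⟩ : ∃ b : ℕ → Set X, IsTopologicalBasis (Set.range b) := by
    have hbasis := (isBasis_countableBasis X).insert_empty
    obtain ⟨b, hb⟩ := ((countable_countableBasis X).insert ∅).exists_eq_range
      (Set.insert_nonempty _ _)
    exact ⟨b, hb ▸ hbasis⟩
  exact ⟨standardDomain b, standardRep b,
    (isOpenMap_standardRep hb).isQuotientMap (continuous_standardRep hb)
      (surjective_standardRep hb),
    exists_continuous_lift_standardRep hb⟩

end Admissible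

/-! ### The Scott topology on the unit interval and on lattices of open sets -/

section Scott

open Topology (WithScott)

lemma isOpen_withScott_iff {α : Type u} [Preorder α] {s : Set (WithScott α)} :
    IsOpen s ↔ IsUpperSet s ∧ DirSupInacc s := by
  rw [Topology.IsScott.isOpen_iff_isUpperSet_and_dirSupInaccOn (D := Set.univ), dirSupInaccOn_univ]

lemma isOpen_setOf_lt_ofScott (r : ℝ) :
    IsOpen {t : WithScott unitInterval | r < (WithScott.ofScott t : unitInterval)} := by
  refine isOpen_withScott_iff.2 ⟨fun s t hst hs => Set.mem_ofPred.2 ((Set.mem_ofPred.1 hs).trans_le hst), ?_⟩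
  intro d hd _ a ha hra
  by_contra hne
  have hle : ∀ t ∈ d, ((WithScott.ofScott t : unitInterval) : ℝ) ≤ r := fun t ht =>
    not_lt.1 fun h => hne ⟨t, ht, h⟩
  obtain ⟨t, ht⟩ := hd
  have hr : r ∈ unitInterval :=
    ⟨(WithScott.ofScott t).2.1.trans (hle t ht), hra.le.trans (WithScott.ofScott a).2.2⟩
  have : a ≤ WithScott.toScott (⟨r, hr⟩ : unitInterval) := ha.2 fun t ht => hle t ht
  exact not_lt.2 this (Set.mem_ofPred.1 hra)

/-- Convergence in the Scott topology of the unit interval is convergence from below. -/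
lemma tendsto_withScott_unitInterval {ι : Type*} {l : Filter ι}
    {f : ι → WithScott unitInterval} {a : WithScott unitInterval}
    (h : ∀ r : ℝ, r < (WithScott.ofScott a : unitInterval) →
      ∀ᶠ i in l, r < (WithScott.ofScott (f i) : unitInterval)) :
    Tendsto f l (𝓝 a) := by
  refine tendsto_nhds.2 fun U hU haU => ?_
  obtain ⟨hup, hacc⟩ := isOpen_withScott_iff.1 hU
  rcases eq_or_ne (WithScott.ofScott a) 0 with h0 | h0
  · refine Eventually.of_forall fun i => hup ?_ haU
    change WithScott.ofScott a ≤ WithScott.ofScott (f i)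
    rw [h0]
    exact (WithScott.ofScott (f i)).2.1
  · have hpos : (0 : unitInterval) < WithScott.ofScott a := unitInterval.pos_iff_ne_zero.2 h0
    obtain ⟨q, hqa, hqU⟩ := hacc (d := {t : WithScott unitInterval |
        WithScott.ofScott t < WithScott.ofScott a})
      ⟨WithScott.toScott 0, hpos⟩
      (by
        intro s hs t ht
        rcases le_total (WithScott.ofScott s) (WithScott.ofScott t) with hst | hst
        · exact ⟨t, ht, hst, le_refl t⟩
        · exact ⟨s, hs, le_refl s, hst⟩)
      (a := a)
      ⟨fun t ht => le_of_lt ht, fun c hc => le_of_not_gt fun hca => by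
        obtain ⟨m, hcm, hma⟩ :=
          exists_between (show WithScott.ofScott c < WithScott.ofScott a from hca)
        exact absurd (hc (a := WithScott.toScott m) hma) (not_le_of_gt hcm)⟩
      haU
    filter_upwards [h _ hqa] with i hi
    exact hup (le_of_lt (show WithScott.ofScott q < WithScott.ofScott (f i) from hi)) hqU

variable {X : Type u} [TopologicalSpace X]

lemma isOpen_setOf_isCompact_subset {K : Set X} (hK : IsCompact K) :
    IsOpen {U : WithScott (Opens X) | K ⊆ (WithScott.ofScott U : Opens X)} := by
  refine isOpen_withScott_iff.2 ⟨fun U V hUV hU => Set.mem_ofPred.2 ((Set.mem_ofPred.1 hU).trans hUV), ?_⟩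
  intro d hd hdir U hU hKU
  have hle : WithScott.ofScott U ≤ ⨆ V : d, WithScott.ofScott V.1 :=
    hU.2 fun V hV => le_iSup (fun V : d => WithScott.ofScott V.1) ⟨V, hV⟩
  have : Nonempty d := hd.to_subtype
  obtain ⟨V, hV⟩ := hK.elim_directed_cover (fun V : d => ((WithScott.ofScott V.1 : Opens X) : Set X))
    (fun V => (WithScott.ofScott V.1).isOpen)
    (fun x hx => by simpa using hle (hKU hx))
    (by
      intro V W
      obtain ⟨Z, hZ, hVZ, hWZ⟩ := hdir V V.2 W W.2
      exact ⟨⟨Z, hZ⟩, hVZ, hWZ⟩)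
  exact ⟨V, V.2, hV⟩

/-- In a first countable space, Scott convergence of open sets is continuous convergence of their
characteristic functions. -/
lemma eventually_mem_of_tendsto_withScott [FirstCountableTopology X]
    {U : ℕ → WithScott (Opens X)} {V : WithScott (Opens X)} (h : Tendsto U atTop (𝓝 V)) {p : X}
    (hp : p ∈ (WithScott.ofScott V : Opens X)) :
    ∀ᶠ z : ℕ × X in atTop ×ˢ 𝓝 p, z.2 ∈ (WithScott.ofScott (U z.1) : Opens X) := by
  by_contra hne
  obtain ⟨z, hz, hzU⟩ := exists_seq_forall_of_frequently (not_eventually.1 hne)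
  obtain ⟨hz1, hz2⟩ := tendsto_prod_iff'.1 hz
  obtain ⟨N, hN⟩ := eventually_atTop.1 (hz2 ((WithScott.ofScott V).isOpen.mem_nhds hp))
  have hshift : Tendsto (fun k => (z (k + N)).2) atTop (𝓝 p) :=
    hz2.comp (tendsto_add_atTop_nat N)
  have hVK : insert p (Set.range fun k => (z (k + N)).2) ⊆ (WithScott.ofScott V : Opens X) := by
    refine Set.insert_subset hp ?_
    rintro _ ⟨k, rfl⟩
    exact hN _ (Nat.le_add_left _ _)
  have hev := h ((isOpen_setOf_isCompact_subset hshift.isCompact_insert_range).mem_nhds hVK)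
  obtain ⟨k, hk, hkN⟩ := ((hz1.eventually hev).and (eventually_ge_atTop N)).exists
  refine hzU k (hk (Set.mem_insert_of_mem _ ⟨k - N, ?_⟩))
  simp [Nat.sub_add_cancel hkN]

/-- A second countable space has a countable basis of open sets that is closed under finite
unions. -/
lemma exists_countable_sup_closed_basis (X : Type u) [TopologicalSpace X]
    [SecondCountableTopology X] :
    ∃ S : Set (Opens X), S.Countable ∧ ⊥ ∈ S ∧ SupClosed S ∧
      ∀ (U : Opens X) (p : X), p ∈ U → ∃ V ∈ S, p ∈ V ∧ V ≤ U := by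
  obtain ⟨B, hBc, -, hB⟩ := exists_countable_basis X
  let S₀ : Set (Opens X) := {V | (V : Set X) ∈ B}
  have hS₀ : S₀.Countable := hBc.preimage SetLike.coe_injective
  refine ⟨sSup '' {t | t.Finite ∧ t ⊆ S₀}, (Set.countable_ofPred_finite_subset hS₀).image _,
    ⟨∅, ⟨Set.finite_empty, Set.empty_subset _⟩, sSup_empty⟩, ?_, ?_⟩
  · rintro _ ⟨s, ⟨hs, hs'⟩, rfl⟩ _ ⟨t, ⟨ht, ht'⟩, rfl⟩
    exact ⟨s ∪ t, ⟨hs.union ht, Set.union_subset hs' ht'⟩, sSup_union⟩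
  · intro U p hp
    obtain ⟨V, hV, hpV, hVU⟩ := hB.exists_subset_of_mem_open hp U.isOpen
    exact ⟨⟨V, hB.isOpen hV⟩, ⟨{⟨V, hB.isOpen hV⟩}, ⟨Set.finite_singleton _, by
      simpa [S₀] using hV⟩, sSup_singleton⟩, hpV, hVU⟩

end Scott

end TopDom

namespace TopDom

open Topology (WithScott)

/-! ### The topology of the function space `𝒪^⊆(X) ⇒ [0,1]^↑` -/

namespace OpensToUnit

section General

variable {X : Type u} [TopologicalSpace X]

lemma val_mono (ν : OpensToUnit X) : Monotone ν.val := fun U V hUV =>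
  Topology.IsScott.monotone_of_continuous (D := Set.univ) (map_continuous ν)
    (show WithScott.toScott U ≤ WithScott.toScott V from hUV)

lemma isOpen_setOf_lt_val (ν : OpensToUnit X) (r : ℝ) :
    IsOpen {U : WithScott (Opens X) | r < ν.val (WithScott.ofScott U)} :=
  (isOpen_setOf_lt_ofScott r).preimage (map_continuous ν)

lemma ext_val {μ ν : OpensToUnit X} (h : ∀ U, μ.val U = ν.val U) : μ = ν :=
  DFunLike.ext μ ν fun U => h (WithScott.ofScott U)

/-- The basic open sets of the function space. -/
lemma isOpen_setOf_lt (U : Opens X) (r : ℝ) : IsOpen {ν : OpensToUnit X | r < ν.val U} := by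
  intro f g hg hfg
  have h := hfg (fun _ => WithScott.toScott U) (WithScott.toScott U) tendsto_const_nhds
  exact h ((isOpen_setOf_lt_ofScott r).mem_nhds hg)

instance : T0Space (OpensToUnit X) := by
  refine ⟨fun μ ν h => ext_val fun U => le_antisymm ?_ ?_⟩
  · refine le_of_forall_lt fun q hq => ?_
    exact (h.mem_open_iff (isOpen_setOf_lt U q)).1 hq
  · refine le_of_forall_lt fun q hq => ?_
    exact (h.mem_open_iff (isOpen_setOf_lt U q)).2 hq

lemma val_le_of_specLE {μ ν : OpensToUnit X} (h : SpecLE μ ν) (U : Opens X) :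
    μ.val U ≤ ν.val U :=
  le_of_forall_lt fun q hq => h _ (isOpen_setOf_lt U q) hq

/-- An element of the function space from a map whose strict superlevel sets are Scott open. -/
def ofIsOpen (g : Opens X → unitInterval)
    (hg : ∀ r : ℝ, IsOpen {U : WithScott (Opens X) | r < g (WithScott.ofScott U)}) :
    OpensToUnit X :=
  (⟨fun U => WithScott.toScott (g (WithScott.ofScott U)), continuous_iff_continuousAt.2 fun _ =>
    tendsto_withScott_unitInterval fun r hr => (hg r).mem_nhds (Set.mem_ofPred.2 hr)⟩ :
    C(WithScott (Opens X), WithScott unitInterval))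

/-- A pointwise limit from below of elements of the function space. -/
lemma exists_tendsto_of_monotone (c : ℕ → OpensToUnit X) (hc : ∀ U, Monotone fun n => (c n).val U) :
    ∃ ν : OpensToUnit X, (∀ n U, (c n).val U ≤ ν.val U) ∧
      ∀ U, Tendsto (fun n => ((c n).val U : ℝ)) atTop (𝓝 (ν.val U : ℝ)) := by
  have hbdd : ∀ U, BddAbove (Set.range fun n => ((c n).val U : ℝ)) := fun U =>
    ⟨1, by rintro _ ⟨n, rfl⟩; exact ((c n).val U).2.2⟩
  have hmem : ∀ U, (⨆ n, ((c n).val U : ℝ)) ∈ unitInterval := fun U =>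
    ⟨((c 0).val U).2.1.trans (le_ciSup (hbdd U) 0), ciSup_le fun n => ((c n).val U).2.2⟩
  refine ⟨ofIsOpen (fun U => ⟨⨆ n, ((c n).val U : ℝ), hmem U⟩) fun r => ?_, fun n U =>
    le_ciSup (hbdd U) n, fun U => tendsto_atTop_ciSup (fun _ _ h => hc U h) (hbdd U)⟩
  have : {U : WithScott (Opens X) | r < ⨆ n, ((c n).val (WithScott.ofScott U) : ℝ)} =
      ⋃ n, {U | r < (c n).val (WithScott.ofScott U)} := by
    ext U
    simp [lt_ciSup_iff (hbdd _)]
  exact this ▸ isOpen_iUnion fun n => (c n).isOpen_setOf_lt_val r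

end General

section SecondCountable

variable {X : Type u} [TopologicalSpace X]

/-- Continuous convergence can be tested on a basis of open sets that is closed under finite
unions. -/
lemma contConv_of_basis [FirstCountableTopology X] {S : Set (Opens X)} (hbot : ⊥ ∈ S)
    (hsup : SupClosed S) (hS : ∀ (U : Opens X) (p : X), p ∈ U → ∃ V ∈ S, p ∈ V ∧ V ≤ U)
    {f : ℕ → OpensToUnit X} {g : OpensToUnit X}
    (h : ∀ V ∈ S, ∀ q : ℚ, (q : ℝ) < g.val V → ∀ᶠ n in atTop, (q : ℝ) < (f n).val V) :
    ContConv f g := by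
  intro U A hUA
  refine tendsto_withScott_unitInterval fun r hr => ?_
  obtain ⟨q, hrq, hq⟩ := exists_rat_btwn hr
  let d : Set (WithScott (Opens X)) :=
    {V | WithScott.ofScott V ∈ S ∧ ∀ᶠ n in atTop, WithScott.ofScott V ≤ WithScott.ofScott (U n)}
  have hAd : WithScott.ofScott A ≤ sSup (WithScott.ofScott '' d) := by
    intro p hp
    obtain ⟨P, hP, Q, hQ, hPQ⟩ :=
      eventually_prod_iff.1 (eventually_mem_of_tendsto_withScott hUA hp)
    obtain ⟨W, hWQ, hW, hpW⟩ := mem_nhds_iff.1 hQ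
    obtain ⟨V, hVS, hpV, hVW⟩ := hS ⟨W, hW⟩ p hpW
    have hVd : WithScott.toScott V ∈ d :=
      ⟨hVS, hP.mono fun n hn y hy => hPQ hn (hWQ (hVW hy))⟩
    exact le_sSup (Set.mem_image_of_mem WithScott.ofScott hVd) hpV
  have hlub : IsLUB d (WithScott.toScott (sSup (WithScott.ofScott '' d))) :=
    ⟨fun V hV => le_sSup (Set.mem_image_of_mem WithScott.ofScott hV),
      fun C hC => sSup_le (a := WithScott.ofScott C) (by
        rintro _ ⟨V, hV, rfl⟩; exact hC hV)⟩
  have hdir : DirectedOn (· ≤ ·) d := fun V hV W hW =>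
    ⟨WithScott.toScott (WithScott.ofScott V ⊔ WithScott.ofScott W),
      ⟨hsup hV.1 hW.1, by filter_upwards [hV.2, hW.2] with n h₁ h₂ using sup_le h₁ h₂⟩,
      le_sup_left (a := WithScott.ofScott V), le_sup_right (a := WithScott.ofScott V)⟩
  have hne : d.Nonempty := ⟨WithScott.toScott ⊥, hbot, Eventually.of_forall fun n => bot_le⟩
  have hqsup : (q : ℝ) < g.val (sSup (WithScott.ofScott '' d)) := hq.trans_le (g.val_mono hAd)
  obtain ⟨V, hVd, hqV⟩ := (isOpen_withScott_iff.1 (g.isOpen_setOf_lt_val q)).2 hne hdir hlub hqsup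
  filter_upwards [hVd.2, h _ hVd.1 q hqV] with n hn hqn
  exact hrq.trans (hqn.trans_le ((f n).val_mono hn))

/-- The topology of the function space is generated by countably many of the sets
`{ν | q < ν V}`. -/
lemma eq_generateFrom {S : Set (Opens X)} [FirstCountableTopology X] (hcount : S.Countable)
    (hbot : ⊥ ∈ S) (hsup : SupClosed S)
    (hS : ∀ (U : Opens X) (p : X), p ∈ U → ∃ V ∈ S, p ∈ V ∧ V ≤ U) :
    (instTopologicalSpaceFunSpace : TopologicalSpace (OpensToUnit X)) = generateFrom
      (Set.range fun i : S × ℚ => {ν : OpensToUnit X | (i.2 : ℝ) < ν.val i.1}) := by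
  refine le_antisymm (le_generateFrom ?_) ?_
  · rintro _ ⟨i, rfl⟩
    exact isOpen_setOf_lt i.1.1 i.2
  · have := hcount.to_subtype
    set τ := generateFrom
      (Set.range fun i : S × ℚ => {ν : OpensToUnit X | (i.2 : ℝ) < ν.val i.1}) with hτ
    have h2 : @SecondCountableTopology _ τ := @SecondCountableTopology.mk _ τ
      ⟨_, Set.countable_range _, rfl⟩
    have h1 : @FirstCountableTopology _ τ := @SecondCountableTopology.to_firstCountableTopology _ τ h2
    intro G hG
    refine (@isOpen_iff_mem_nhds _ τ G).2 fun g hg => ?_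
    have : (@nhds _ τ g).IsCountablyGenerated := @FirstCountableTopology.nhds_generated_countable _ τ h1 g
    by_contra hne
    obtain ⟨f, hf, hfG⟩ := exists_seq_forall_of_frequently
      (not_eventually.1 (show ¬ ∀ᶠ ν in @nhds _ τ g, ν ∈ G from hne))
    have hconv : ContConv f g := contConv_of_basis hbot hsup hS fun V hV q hq =>
      hf.eventually (@IsOpen.mem_nhds _ τ g {ν | (q : ℝ) < ν.val V}
        (isOpen_generateFrom_of_mem ⟨(⟨V, hV⟩, q), rfl⟩) hq)
    obtain ⟨n, hn⟩ := (hG f g hg hconv).exists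
    exact hfG n hn

instance [SecondCountableTopology X] : SecondCountableTopology (OpensToUnit X) := by
  obtain ⟨S, hc, hbot, hsup, hS⟩ := exists_countable_sup_closed_basis X
  have := hc.to_subtype
  exact ⟨⟨_, Set.countable_range _, eq_generateFrom hc hbot hsup hS⟩⟩

lemma tendsto_of_forall_tendsto_val [SecondCountableTopology X] {f : ℕ → OpensToUnit X}
    {g : OpensToUnit X}
    (h : ∀ U, Tendsto (fun n => ((f n).val U : ℝ)) atTop (𝓝 (g.val U : ℝ))) :
    Tendsto f atTop (𝓝 g) := by
  obtain ⟨S, -, hbot, hsup, hS⟩ := exists_countable_sup_closed_basis X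
  have hconv : ContConv f g := contConv_of_basis hbot hsup hS fun V _ q hq =>
    (h V).eventually (lt_mem_nhds hq)
  exact tendsto_nhds.2 fun G hG hg => hG f g hg hconv

lemma continuous_of_isOpen_setOf_lt [SecondCountableTopology X] {Z : Type v} [TopologicalSpace Z]
    {φ : Z → OpensToUnit X} (h : ∀ (U : Opens X) (r : ℝ), IsOpen {z | r < (φ z).val U}) :
    Continuous φ := by
  obtain ⟨S, hc, hbot, hsup, hS⟩ := exists_countable_sup_closed_basis X
  refine continuous_iff_le_induced.2 ?_
  rw [eq_generateFrom hc hbot hsup hS, induced_generateFrom_eq]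
  refine le_generateFrom ?_
  rintro _ ⟨_, ⟨i, rfl⟩, rfl⟩
  exact h i.1.1 i.2

lemma specLE_of_forall_val_le [SecondCountableTopology X] {μ ν : OpensToUnit X}
    (h : ∀ U, μ.val U ≤ ν.val U) : SpecLE μ ν := by
  obtain ⟨S, -, hbot, hsup, hS⟩ := exists_countable_sup_closed_basis X
  have hconv : ContConv (fun _ => ν) μ := contConv_of_basis hbot hsup hS fun V _ q hq =>
    Eventually.of_forall fun _ => hq.trans_le (h V)
  intro G hG hμ
  exact (hG (fun _ => ν) μ hμ hconv).exists.choose_spec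

/-- The supremum of an ascending chain in the function space. -/
lemma exists_chain_limit [SecondCountableTopology X] (c : ℕ → OpensToUnit X)
    (hc : ∀ n, SpecLE (c n) (c (n + 1))) :
    ∃ ν : OpensToUnit X, (∀ n, SpecLE (c n) ν) ∧ Tendsto c atTop (𝓝 ν) ∧
      ∀ U, Tendsto (fun n => ((c n).val U : ℝ)) atTop (𝓝 (ν.val U : ℝ)) := by
  obtain ⟨ν, hle, hν⟩ := exists_tendsto_of_monotone c fun U =>
    monotone_nat_of_le_succ fun n => val_le_of_specLE (hc n) U
  exact ⟨ν, fun n => specLE_of_forall_val_le (hle n), tendsto_of_forall_tendsto_val hν, hν⟩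

end SecondCountable

/-! ### Pushforward -/

section Map

variable {X Y Z : Type u} [TopologicalSpace X] [TopologicalSpace Y] [TopologicalSpace Z]

lemma continuous_comap_withScott (f : C(X, Y)) :
    Continuous fun U : WithScott (Opens Y) =>
      WithScott.toScott (Opens.comap f (WithScott.ofScott U)) := by
  rw [← Topology.IsScott.scottContinuousOn_iff_continuous (D := Set.univ) fun _ _ _ => trivial]
  intro d _ _ _ A hA
  refine ⟨?_, fun C hC => ?_⟩
  · rintro _ ⟨V, hV, rfl⟩
    exact Opens.comap_mono f (hA.1 hV)
  · intro p hp
    have hle : WithScott.ofScott A ≤ sSup (WithScott.ofScott '' d) :=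
      hA.2 (show WithScott.toScott (sSup (WithScott.ofScott '' d)) ∈ upperBounds d from
        fun V hV => le_sSup (Set.mem_image_of_mem WithScott.ofScott hV))
    have hp' : f p ∈ sSup (WithScott.ofScott '' d) := hle hp
    obtain ⟨_, ⟨V, hV, rfl⟩, hpV⟩ := Opens.mem_sSup.1 hp'
    exact hC (Set.mem_image_of_mem _ hV) hpV

/-- The pushforward `μ ↦ μ ∘ f⁻¹`. -/
def map (f : C(X, Y)) (μ : OpensToUnit X) : OpensToUnit Y :=
  (⟨fun U => μ (WithScott.toScott (Opens.comap f (WithScott.ofScott U))),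
    (map_continuous μ).comp (continuous_comap_withScott f)⟩ :
    C(WithScott (Opens Y), WithScott unitInterval))

lemma continuous_map [SecondCountableTopology Y] (f : C(X, Y)) : Continuous (map f) :=
  continuous_of_isOpen_setOf_lt fun U r => isOpen_setOf_lt (Opens.comap f U) r

lemma _root_.TopDom.IsValuation.map {μ : OpensToUnit X} (h : IsValuation μ) (f : C(X, Y)) :
    IsValuation (μ.map f) where
  strict := h.strict
  monotone _ _ hUV := h.monotone _ _ (Opens.comap_mono f hUV)
  modular U V := h.modular (Opens.comap f U) (Opens.comap f V)

end Map

end OpensToUnit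

/-! ### The spaces and the functors -/

section Functors

variable {X : Type u} [TopologicalSpace X]

lemma isCountablyBasedPredomain_opensToUnit [SecondCountableTopology X] :
    isCountablyBasedPredomain (TopCat.of (OpensToUnit X)) := by
  refine ⟨⟨isQCB0_of_secondCountable (OpensToUnit X), fun c hc => ?_⟩,
    inferInstanceAs (SecondCountableTopology (OpensToUnit X))⟩
  obtain ⟨ν, hle, hν, -⟩ := OpensToUnit.exists_chain_limit c hc
  exact ⟨ν, hle, hν⟩

lemma specLE_subtype_iff {p : X → Prop} {x y : Subtype p} : SpecLE x y ↔ SpecLE x.1 y.1 := by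
  constructor
  · intro h U hU hx
    exact h _ (hU.preimage continuous_subtype_val) hx
  · rintro h _ ⟨U, hU, rfl⟩ hx
    exact h U hU hx

lemma isValuation_of_tendsto {c : ℕ → OpensToUnit X} {ν : OpensToUnit X}
    (hc : ∀ n, IsValuation (c n))
    (h : ∀ U, Tendsto (fun n => ((c n).val U : ℝ)) atTop (𝓝 (ν.val U : ℝ))) : IsValuation ν where
  strict := by
    have h0 := h ⊥
    simp only [(hc _).strict] at h0
    exact Subtype.ext (tendsto_nhds_unique h0 tendsto_const_nhds)
  monotone U V hUV := ν.val_mono hUV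
  modular U V := by
    refine tendsto_nhds_unique ((h U).add (h V)) ?_
    simp only [(hc _).modular U V]
    exact (h _).add (h _)

instance [SecondCountableTopology X] : SecondCountableTopology (Valuation X) :=
  IsInducing.subtypeVal.secondCountableTopology

lemma isCountablyBasedPredomain_valuation [SecondCountableTopology X] :
    isCountablyBasedPredomain (TopCat.of (Valuation X)) := by
  refine ⟨⟨isQCB0_of_secondCountable (Valuation X), fun c hc => ?_⟩,
    inferInstanceAs (SecondCountableTopology (Valuation X))⟩
  obtain ⟨ν, hle, hν, hval⟩ := OpensToUnit.exists_chain_limit (fun n => (c n).1)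
    fun n => specLE_subtype_iff.1 (hc n)
  exact ⟨⟨ν, isValuation_of_tendsto (fun n => (c n).2) hval⟩,
    fun n => specLE_subtype_iff.2 (hle n), tendsto_subtype_rng.2 hν⟩

instance (D : TPω.{u}) : SecondCountableTopology D.obj := D.property.2

/-- The functor `D ↦ (𝒪^⊆(D) ⇒ [0,1]^↑)`. -/
def opensToUnitFunctor : TPω.{u} ⥤ TPω.{u} where
  obj D := ⟨TopCat.of (OpensToUnit D.obj), isCountablyBasedPredomain_opensToUnit⟩
  map f := ObjectProperty.homMk (TopCat.ofHom
    ⟨OpensToUnit.map f.hom.hom, OpensToUnit.continuous_map f.hom.hom⟩)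

/-- The probability functor `D ↦ 𝒱(D)`. -/
def valuationFunctor : TPω.{u} ⥤ TPω.{u} where
  obj D := ⟨TopCat.of (Valuation D.obj), isCountablyBasedPredomain_valuation⟩
  map f := ObjectProperty.homMk (TopCat.ofHom
    ⟨fun μ => ⟨OpensToUnit.map f.hom.hom μ.1, μ.2.map f.hom.hom⟩,
      ((OpensToUnit.continuous_map f.hom.hom).comp continuous_subtype_val).subtype_mk _⟩)

end Functors

end TopDom

theorem mainTheorem5 :
    -- the functor on the full function spaces
    (∃ (hobj : ∀ D : TopDom.TPω.{u},
          TopDom.isCountablyBasedPredomain (TopCat.of (TopDom.OpensToUnit D.obj)))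
        (Q : TopDom.TPω.{u} ⥤ TopDom.TPω.{u})
        (hQ : ∀ D : TopDom.TPω.{u}, Q.obj D = ⟨TopCat.of (TopDom.OpensToUnit D.obj), hobj D⟩),
        ∀ (D E : TopDom.TPω.{u}) (f : D ⟶ E) (μ : TopDom.OpensToUnit D.obj) (U : Opens E.obj),
          TopDom.OpensToUnit.val
              ((eqToHom (hQ D).symm ≫ Q.map f ≫ eqToHom (hQ E)).hom.hom μ) U =
            μ.val (Opens.comap f.hom.hom U)) ∧
    -- the functor on the spaces of valuations
    (∃ (hobj : ∀ D : TopDom.TPω.{u},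
          TopDom.isCountablyBasedPredomain (TopCat.of (TopDom.Valuation D.obj)))
        (P : TopDom.TPω.{u} ⥤ TopDom.TPω.{u})
        (hP : ∀ D : TopDom.TPω.{u}, P.obj D = ⟨TopCat.of (TopDom.Valuation D.obj), hobj D⟩),
        ∀ (D E : TopDom.TPω.{u}) (f : D ⟶ E) (μ : TopDom.Valuation D.obj) (U : Opens E.obj),
          TopDom.OpensToUnit.val
              (((eqToHom (hP D).symm ≫ P.map f ≫ eqToHom (hP E)).hom.hom μ).1) U =
            μ.1.val (Opens.comap f.hom.hom U)) :=
  ⟨⟨fun _ => TopDom.isCountablyBasedPredomain_opensToUnit, TopDom.opensToUnitFunctor, fun _ => rfl,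
      fun _ _ _ _ _ => rfl⟩,
    ⟨fun _ => TopDom.isCountablyBasedPredomain_valuation, TopDom.valuationFunctor, fun _ => rfl,
      fun _ _ _ _ _ => rfl⟩⟩
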